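/- Let $s \ge 1$ and $p \ge 1$ be fixed integers. Then, as $n \to \infty$ through the positive integers, $$\sum_{\substack{a_1,\ldots,a_s \in \mathbb{Z}_{\ge 0}\\ a_1+\cdots+a_s=n}} \binom{n}{a_1,\ldots,a_s}^{p} \;\sim\; s^{pn}\sqrt{\frac{s^{s(p-1)}}{p^{\,s-1}\,(2\pi n)^{(s-1)(p-1)}}},$$ where $\binom{n}{a_1,\ldots,a_s}=\frac{n!}{a_1!\cdots a_s!}$ is the multinomial coefficient, and $f(n)\sim g(n)$ means that $f(n)/g(n)\to 1$. -/

import Mathlib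

/-! Write R(a) = (pa)! / (p^(pa) a!^p). The powers of p cancel in multinomial(a)^p = R(n)⁻¹ ·
multinomial(p•a) · ∏ R(a_i), which turns the p-th power into one multinomial coefficient of total pn
times a slowly varying factor.

The coefficients multinomial(p•a) sum to about s^(pn) / p^(s-1): a roots of unity filter selects the
tuples divisible by p, and only constant tuples of roots survive in the limit
(`tendsto_sum_multinomial_nsmul`). By a Chernoff bound the mass sits near a_i = n/s
(`sum_multinomial_nsmul_tail_le`), where Stirling gives R(a_i) ≈ √p (2πn/s)^(-(p-1)/2). Off this
region the normalised product is at most polynomial in n, so the exponentially small tail absorbs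
it. Multiplying by R(n)⁻¹, again by Stirling, gives the constant. -/

/-! ### Factorial ratios and Stirling's formula -/

/-- The ratio between `(p a)!` and `p ^ (p a) * a! ^ p`. -/
noncomputable def factorialRatio (p a : ℕ) : ℝ :=
  ((p * a).factorial : ℝ) / ((p : ℝ) ^ (p * a) * (a.factorial : ℝ) ^ p)

lemma factorialRatio_pos {p : ℕ} (hp : 1 ≤ p) (a : ℕ) : 0 < factorialRatio p a := by
  unfold factorialRatio
  have : (0 : ℝ) < p := by exact_mod_cast hp
  positivity

/-- The quotient (pa)! / a!^p is a single term of the multinomial expansion of (1 + ⋯ + 1)^(pa) =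
p^(pa). -/
lemma factorialRatio_le_one {p : ℕ} (hp : 1 ≤ p) (a : ℕ) : factorialRatio p a ≤ 1 := by
  have hp' : (0 : ℝ) < p := by exact_mod_cast hp
  unfold factorialRatio
  rw [div_le_one (by positivity)]
  have hspec := Nat.multinomial_spec (Finset.univ : Finset (Fin p)) (fun _ => a)
  have hsum := Finset.sum_pow_eq_sum_piAntidiag (Finset.univ : Finset (Fin p))
    (fun _ => (1 : ℕ)) (p * a)
  simp only [Finset.prod_const, Finset.card_univ, Fintype.card_fin, Finset.sum_const,
    smul_eq_mul, mul_one, one_pow, Nat.cast_id] at hspec hsum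
  have hle : Nat.multinomial (Finset.univ : Finset (Fin p)) (fun _ => a) ≤ p ^ (p * a) := by
    rw [hsum]
    refine Finset.single_le_sum (f := fun k => Nat.multinomial (Finset.univ : Finset (Fin p)) k)
      (fun _ _ => Nat.zero_le _) ?_
    simp [Finset.mem_piAntidiag]
  have : (p * a).factorial ≤ p ^ (p * a) * a.factorial ^ p := by
    rw [← hspec, mul_comm]
    gcongr
  exact_mod_cast this

/-- By Stirling, `factorialRatio p a` is asymptotic to `√p / √(2 π a) ^ (p - 1)`. -/
lemma tendsto_factorialRatio {p : ℕ} (hp : 1 ≤ p) :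
    Filter.Tendsto
      (fun a : ℕ => factorialRatio p a * √(2 * Real.pi * a) ^ (p - 1) / √(p : ℝ))
      Filter.atTop (nhds 1) := by
  have hp' : (0 : ℝ) < p := by exact_mod_cast hp
  have hst := Stirling.tendsto_stirlingSeq_sqrt_pi
  have hmul : Filter.Tendsto (fun a : ℕ => p * a) Filter.atTop Filter.atTop :=
    Filter.tendsto_id.const_mul_atTop' (by omega)
  have hpi : (0 : ℝ) < √Real.pi := Real.sqrt_pos.2 Real.pi_pos
  have hlim := ((hst.comp hmul).div (hst.pow p) (by positivity)).mul_const (√Real.pi ^ (p - 1))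
  have hone : √Real.pi / √Real.pi ^ p * √Real.pi ^ (p - 1) = 1 := by
    obtain ⟨q, rfl⟩ : ∃ q, p = q + 1 := ⟨p - 1, by omega⟩
    simp only [Nat.add_sub_cancel, pow_succ]
    field_simp
  rw [hone] at hlim
  refine hlim.congr' ?_
  filter_upwards [Filter.eventually_gt_atTop 0] with a ha
  have ha' : (0 : ℝ) < a := by exact_mod_cast ha
  have hsa : (0 : ℝ) < √(a : ℝ) := Real.sqrt_pos.2 ha'
  have hsp : (0 : ℝ) < √(p : ℝ) := Real.sqrt_pos.2 hp'
  have hs2 : (0 : ℝ) < √(2 : ℝ) := Real.sqrt_pos.2 two_pos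
  simp only [Pi.div_apply, Function.comp_apply, Stirling.stirlingSeq, factorialRatio]
  have h1 : √(2 * Real.pi * a) = √2 * √Real.pi * √(a : ℝ) := by
    rw [Real.sqrt_mul (by positivity), Real.sqrt_mul (by positivity)]
  have h2 : √(2 * (a : ℝ)) = √2 * √(a : ℝ) := Real.sqrt_mul (by positivity) _
  have h3 : √(2 * ((p * a : ℕ) : ℝ)) = √2 * √(p : ℝ) * √(a : ℝ) := by
    push_cast
    rw [Real.sqrt_mul (by positivity), Real.sqrt_mul (by positivity), mul_assoc]
  have h4 : (((p * a : ℕ) : ℝ) / Real.exp 1) ^ (p * a)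
      = (p : ℝ) ^ (p * a) * ((a : ℝ) / Real.exp 1) ^ (p * a) := by
    push_cast
    rw [← mul_pow, mul_div_assoc]
  have h5 : (((a : ℝ) / Real.exp 1) ^ a) ^ p = ((a : ℝ) / Real.exp 1) ^ (p * a) := by
    rw [← pow_mul, mul_comm]
  rw [h1, h2, h3, h4, div_pow _ _ p, mul_pow _ _ p, h5]
  have hE : (0 : ℝ) < ((a : ℝ) / Real.exp 1) ^ (p * a) := by positivity
  generalize ((a : ℝ) / Real.exp 1) ^ (p * a) = E at *
  have hF : (0 : ℝ) < (a.factorial : ℝ) := by positivity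
  obtain ⟨q, rfl⟩ : ∃ q, p = q + 1 := ⟨p - 1, by omega⟩
  simp only [Nat.add_sub_cancel, mul_pow]
  field_simp
  ring

/-- The `p`-th power of a multinomial coefficient in terms of the multinomial coefficient of
the dilated tuple. -/
lemma multinomial_pow_eq {s p n : ℕ} (hp : 1 ≤ p) (a : Fin s → ℕ)
    (ha : a ∈ Finset.piAntidiag (Finset.univ : Finset (Fin s)) n) :
    (Nat.multinomial Finset.univ a : ℝ) ^ p =
      (factorialRatio p n)⁻¹ * ((Nat.multinomial Finset.univ (p • a) : ℝ) *
        ∏ i, factorialRatio p (a i)) := by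
  have hp' : (0 : ℝ) < p := by exact_mod_cast hp
  obtain ⟨hsum, -⟩ := Finset.mem_piAntidiag.1 ha
  have h1 : (∏ i, ((a i).factorial : ℝ)) * (Nat.multinomial Finset.univ a : ℝ) = n.factorial := by
    have := Nat.multinomial_spec Finset.univ a
    rw [hsum] at this
    exact_mod_cast this
  have h2 : (∏ i, ((p * a i).factorial : ℝ)) * (Nat.multinomial Finset.univ (p • a) : ℝ)
      = (p * n).factorial := by
    have := Nat.multinomial_spec Finset.univ (p • a)
    simp only [Pi.smul_apply, smul_eq_mul, ← Finset.mul_sum] at this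
    rw [hsum] at this
    exact_mod_cast this
  have hA : (0 : ℝ) < ∏ i, ((a i).factorial : ℝ) := Finset.prod_pos fun _ _ => by positivity
  have hB : (0 : ℝ) < ∏ i, ((p * a i).factorial : ℝ) := Finset.prod_pos fun _ _ => by positivity
  have h3 : ∏ i, factorialRatio p (a i)
      = (∏ i, ((p * a i).factorial : ℝ)) /
        ((p : ℝ) ^ (p * n) * (∏ i, ((a i).factorial : ℝ)) ^ p) := by
    simp only [factorialRatio, Finset.prod_div_distrib, Finset.prod_mul_distrib, Finset.prod_pow]
    rw [Finset.prod_pow_eq_pow_sum, ← Finset.mul_sum, hsum]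
  rw [h3, factorialRatio, ← h2, ← h1]
  have hM : (0 : ℝ) < (Nat.multinomial Finset.univ (p • a) : ℝ) := by
    exact_mod_cast Nat.multinomial_pos _ _
  have hM' : (0 : ℝ) < (Nat.multinomial Finset.univ a : ℝ) := by
    exact_mod_cast Nat.multinomial_pos _ _
  rw [mul_pow]
  field_simp

/-! ### Chernoff bound -/

/-- Chernoff bound for the lower tail of one coordinate of the multinomial distribution. -/
lemma sum_multinomial_lower_tail_le {s : ℕ} (hs : 1 ≤ s) (N : ℕ) (i : Fin s) {η : ℝ}
    (hη : 0 < η) :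
    ∑ b ∈ Finset.piAntidiag (Finset.univ : Finset (Fin s)) N with
        (b i : ℝ) ≤ (1 - η) * (N / s), (Nat.multinomial Finset.univ b : ℝ)
      ≤ (s : ℝ) ^ N * Real.exp (-(η ^ 2 / (2 * s) * N)) := by
  have hs' : (0 : ℝ) < s := by exact_mod_cast hs
  have hgen := Finset.sum_pow_eq_sum_piAntidiag (Finset.univ : Finset (Fin s))
    (fun j => if j = i then Real.exp (-η) else 1) N
  have hL : ∑ j : Fin s, (if j = i then Real.exp (-η) else 1) = (s - 1) + Real.exp (-η) := by
    rw [← Finset.add_sum_erase _ _ (Finset.mem_univ i),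
      Finset.sum_congr rfl (g := fun _ => (1 : ℝ))
        (fun j hj => if_neg (Finset.ne_of_mem_erase hj))]
    simp [Nat.cast_sub hs, add_comm]
  -- Invert e^η ≥ 1 + η + η²/2, using (1 + η + η²/2)(1 - η + η²/2) = 1 + η⁴/4 ≥ 1.
  have hexp : Real.exp (-η) ≤ 1 - η + η ^ 2 / 2 := by
    have h := Real.quadratic_le_exp_of_nonneg hη.le
    rw [Real.exp_neg, inv_le_comm₀ (Real.exp_pos _) (by nlinarith [sq_nonneg (η - 1)])]
    refine le_trans ?_ h
    rw [inv_le_iff_one_le_mul₀ (by nlinarith [sq_nonneg (η - 1)])]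
    nlinarith [sq_nonneg (η ^ 2)]
  have hbase : (s - 1 : ℝ) + Real.exp (-η) ≤ s * Real.exp (-(η - η ^ 2 / 2) / s) := by
    have := Real.add_one_le_exp (-(η - η ^ 2 / 2) / s)
    calc (s - 1 : ℝ) + Real.exp (-η) ≤ s * (-(η - η ^ 2 / 2) / s + 1) := by
          field_simp; linarith
      _ ≤ _ := by gcongr
  have hbase0 : 0 ≤ (s - 1 : ℝ) + Real.exp (-η) := by
    have : (1 : ℝ) ≤ s := by exact_mod_cast hs
    have := Real.exp_pos (-η)
    linarith
  have hprod : ∀ b : Fin s → ℕ, ∏ j, (if j = i then Real.exp (-η) else 1) ^ b j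
      = Real.exp (-(η * b i)) := by
    intro b
    rw [Finset.prod_eq_single i (fun j _ hj => by simp [hj]) (by simp), if_pos rfl,
      ← Real.exp_nat_mul]
    congr 1; ring
  rw [hL] at hgen
  simp only [hprod] at hgen
  -- Exponential Markov inequality: the weight exp(-η b_i) · c is at least 1 on the tail.
  set c := Real.exp (η * ((1 - η) * (N / s))) with hc
  calc _ ≤ ∑ b ∈ Finset.piAntidiag (Finset.univ : Finset (Fin s)) N with
        (b i : ℝ) ≤ (1 - η) * (N / s),
          (Nat.multinomial Finset.univ b : ℝ) * Real.exp (-(η * b i)) * c := by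
        refine Finset.sum_le_sum fun b hb => ?_
        have hb' := (Finset.mem_filter.1 hb).2
        rw [mul_assoc, hc, ← Real.exp_add]
        refine le_mul_of_one_le_right (Nat.cast_nonneg _) (Real.one_le_exp ?_)
        nlinarith
    _ ≤ ∑ b ∈ Finset.piAntidiag (Finset.univ : Finset (Fin s)) N,
          (Nat.multinomial Finset.univ b : ℝ) * Real.exp (-(η * b i)) * c :=
        Finset.sum_le_sum_of_subset_of_nonneg (Finset.filter_subset _ _)
          fun _ _ _ => by positivity
    _ = ((s - 1 : ℝ) + Real.exp (-η)) ^ N * c := by rw [hgen, Finset.sum_mul]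
    _ ≤ (s * Real.exp (-(η - η ^ 2 / 2) / s)) ^ N * c := by gcongr
    _ = _ := by
        rw [mul_pow, mul_assoc, ← Real.exp_nat_mul, hc, ← Real.exp_add]
        -- The exponents combine as -(η - η²/2) + η(1 - η) = -η²/2, times N/s.
        congr 2
        field_simp
        ring

/-! ### Mass of the tuples divisible by p -/

/-- Restricting a sum over tuples of total `p * n` to multiples of `p`. -/
lemma sum_piAntidiag_nsmul {s p : ℕ} (hp : 1 ≤ p) (n : ℕ) {M : Type*} [AddCommMonoid M]
    (f : (Fin s → ℕ) → M) :
    ∑ a ∈ Finset.piAntidiag (Finset.univ : Finset (Fin s)) n, f (p • a)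
      = ∑ b ∈ Finset.piAntidiag (Finset.univ : Finset (Fin s)) (p * n) with ∀ i, p ∣ b i, f b := by
  have h := Finset.map_nsmul_piAntidiag_univ (ι := Fin s) n (by omega : p ≠ 0)
  calc _ = _ := (Finset.sum_map _ ⟨(p • ·), nsmul_right_injective (by omega : p ≠ 0)⟩ f).symm
    _ = _ := by
      rw [h]
      refine Finset.sum_congr ?_ fun _ _ => rfl
      ext b
      simp

/-- Two distinct vectors of equal norm lie on different rays, so the triangle inequality is strict
for that pair. -/
lemma norm_sum_lt_of_ne {ι : Type*} [Fintype ι] (z : ι → ℂ)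
    (hz : ∀ i, ‖z i‖ = 1) {i k : ι} (hik : z i ≠ z k) :
    ‖∑ j, z j‖ < Fintype.card ι := by
  classical
  have hne : i ≠ k := fun h => hik (by rw [h])
  have hk : k ∈ Finset.univ.erase i := by simp [hne.symm]
  rw [← Finset.add_sum_erase _ _ (Finset.mem_univ i), ← Finset.add_sum_erase _ _ hk, ← add_assoc]
  have h1 : ‖z i + z k‖ < 2 := by
    have := norm_add_lt_of_not_sameRay (x := z i) (y := z k) (by
      rw [sameRay_iff_of_norm_eq (by rw [hz, hz])]
      exact hik)
    rw [hz, hz] at this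
    linarith
  have h2 : ‖∑ x ∈ (Finset.univ.erase i).erase k, z x‖ ≤ (Fintype.card ι : ℝ) - 2 := by
    refine (norm_sum_le _ _).trans ?_
    simp only [hz, Finset.sum_const, nsmul_eq_mul, mul_one]
    have hc := Finset.card_erase_add_one hk
    have hc' := Finset.card_erase_add_one (Finset.mem_univ i)
    rw [Finset.card_univ] at hc'
    have : (((Finset.univ.erase i).erase k).card : ℝ) + 2 = Fintype.card ι := by
      exact_mod_cast (by omega : ((Finset.univ.erase i).erase k).card + 2 = Fintype.card ι)
    linarith
  calc _ ≤ ‖z i + z k‖ + ‖∑ x ∈ (Finset.univ.erase i).erase k, z x‖ := norm_add_le _ _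
    _ < _ := by linarith

/-- Roots of unity filter for multinomial coefficients. -/
lemma sum_multinomial_nsmul_eq {s p : ℕ} (hp : 1 ≤ p) {ω : ℂ} (hω : IsPrimitiveRoot ω p) (n : ℕ) :
    (p : ℂ) ^ s * ∑ a ∈ Finset.piAntidiag (Finset.univ : Finset (Fin s)) n,
        (Nat.multinomial Finset.univ (p • a) : ℂ)
      = ∑ j : Fin s → Fin p, (∑ i, ω ^ (j i : ℕ)) ^ (p * n) := by
  have hinner : ∀ m : ℕ, ∑ x : Fin p, (ω ^ (x : ℕ)) ^ m = if p ∣ m then (p : ℂ) else 0 := by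
    intro m
    rw [Fin.sum_univ_eq_sum_range (fun x => (ω ^ x) ^ m) p]
    simp only [← pow_mul, mul_comm _ m]
    simp only [pow_mul]
    split_ifs with h
    · rw [(hω.pow_eq_one_iff_dvd m).2 h]; simp
    · have hne : ω ^ m ≠ 1 := fun h' => h ((hω.pow_eq_one_iff_dvd m).1 h')
      rw [geom_sum_eq hne, ← pow_mul, mul_comm, pow_mul, hω.pow_eq_one]
      simp
  rw [sum_piAntidiag_nsmul hp n (fun b => (Nat.multinomial Finset.univ b : ℂ)), Finset.mul_sum]
  simp only [Finset.sum_pow_eq_sum_piAntidiag]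
  rw [Finset.sum_comm, Finset.sum_filter]
  refine Finset.sum_congr rfl fun b _ => ?_
  -- For fixed b the sum over j factors into one character sum per coordinate, each p or 0.
  rw [← Finset.mul_sum, ← Fintype.piFinset_univ,
    ← Finset.prod_univ_sum (fun _ => Finset.univ) (fun i (x : Fin p) => (ω ^ (x : ℕ)) ^ b i)]
  simp only [hinner]
  split_ifs with h
  · simp [h, mul_comm]
  · push Not at h
    obtain ⟨i, hi⟩ := h
    rw [Finset.prod_eq_zero (Finset.mem_univ i) (by simp [hi]), mul_zero]

/-- After division by s^(pn), each of the p constant tuples j contributes exactly 1 to the roots of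
unity sum, since ω^(pn) = 1; every other tuple has base of norm below 1 and dies out. The filter's
factor p^s thus leaves p^(s-1). -/
lemma tendsto_sum_multinomial_nsmul {s p : ℕ} (hs : 1 ≤ s) (hp : 1 ≤ p) :
    Filter.Tendsto (fun n : ℕ => ∑ a ∈ Finset.piAntidiag (Finset.univ : Finset (Fin s)) n,
        (Nat.multinomial Finset.univ (p • a) : ℝ) * ((p : ℝ) ^ (s - 1) / (s : ℝ) ^ (p * n)))
      Filter.atTop (nhds 1) := by
  have hpC : (p : ℂ) ≠ 0 := by exact_mod_cast (by omega : p ≠ 0)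
  have hsC : (s : ℂ) ≠ 0 := by exact_mod_cast (by omega : s ≠ 0)
  have hs' : (0 : ℝ) < s := by exact_mod_cast hs
  set ω := Complex.exp (2 * Real.pi * Complex.I / p) with hωdef
  have hω : IsPrimitiveRoot ω p := Complex.isPrimitiveRoot_exp p (by omega)
  have hωn : ‖ω‖ = 1 := hω.norm'_eq_one (by omega)
  let i₀ : Fin s := ⟨0, hs⟩
  have hterm : ∀ j : Fin s → Fin p,
      Filter.Tendsto (fun n : ℕ => ((∑ i, ω ^ (j i : ℕ)) / s) ^ (p * n)) Filter.atTop
        (nhds (if j = fun _ => j i₀ then 1 else 0)) := by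
    intro j
    split_ifs with h
    · have : ∀ n : ℕ, ((∑ i, ω ^ (j i : ℕ)) / s) ^ (p * n) = 1 := by
        intro n
        rw [h]
        simp only [Finset.sum_const, Finset.card_univ, Fintype.card_fin, nsmul_eq_mul]
        rw [mul_div_cancel_left₀ _ hsC, ← pow_mul, ← mul_assoc, mul_comm _ p, mul_assoc, pow_mul,
          hω.pow_eq_one, one_pow]
      simp only [this]
      exact tendsto_const_nhds
    · obtain ⟨i, hi⟩ : ∃ i, j i ≠ j i₀ := by
        by_contra hcon
        push Not at hcon
        exact h (funext hcon)
      have hne : ω ^ (j i : ℕ) ≠ ω ^ (j i₀ : ℕ) := fun he =>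
        hi (Fin.ext (hω.pow_inj (j i).2 (j i₀).2 he))
      have hlt := norm_sum_lt_of_ne (fun i => ω ^ (j i : ℕ)) (fun i => by simp [hωn]) hne
      have hlt' : ‖(∑ i, ω ^ (j i : ℕ)) / (s : ℂ)‖ < 1 := by
        rw [norm_div, Complex.norm_natCast, div_lt_one hs']
        simpa using hlt
      have hmul : Filter.Tendsto (fun a : ℕ => p * a) Filter.atTop Filter.atTop :=
        Filter.tendsto_id.const_mul_atTop' (by omega)
      exact (tendsto_pow_atTop_nhds_zero_of_norm_lt_one hlt').comp hmul
  have hcount : ∑ j : Fin s → Fin p, (if j = fun _ => j i₀ then (1 : ℂ) else 0) = p := by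
    rw [Finset.sum_boole]
    have : (Finset.univ.filter fun j : Fin s → Fin p => j = fun _ => j i₀)
        = Finset.univ.image fun x : Fin p => fun _ : Fin s => x := by
      ext j
      simp only [Finset.mem_filter, Finset.mem_univ, true_and, Finset.mem_image]
      exact ⟨fun h => ⟨j i₀, h.symm⟩, by rintro ⟨x, rfl⟩; rfl⟩
    rw [this, Finset.card_image_of_injective _ (fun x y h => congrFun h i₀)]
    simp
  have hlim := (tendsto_finsetSum Finset.univ fun j _ => hterm j).div_const (p : ℂ)
  rw [hcount, div_self hpC] at hlim
  have hre := (Complex.continuous_re.tendsto _).comp hlim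
  rw [Complex.one_re] at hre
  refine hre.congr fun n => ?_
  simp only [Function.comp_apply, div_pow, ← Finset.sum_div]
  rw [← sum_multinomial_nsmul_eq hp hω n, ← Finset.sum_mul]
  have : (p : ℂ) ^ s * (∑ a ∈ Finset.piAntidiag (Finset.univ : Finset (Fin s)) n,
        (Nat.multinomial Finset.univ (p • a) : ℂ)) / (s : ℂ) ^ (p * n) / p
      = (((∑ a ∈ Finset.piAntidiag (Finset.univ : Finset (Fin s)) n,
        (Nat.multinomial Finset.univ (p • a) : ℝ)) *
          ((p : ℝ) ^ (s - 1) / (s : ℝ) ^ (p * n)) : ℝ) : ℂ) := by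
    push_cast
    obtain ⟨t, rfl⟩ : ∃ t, s = t + 1 := ⟨s - 1, by omega⟩
    simp only [Nat.add_sub_cancel, pow_succ (p : ℂ) t]
    field_simp
  rw [this, Complex.ofReal_re]

/-! ### Tail estimate for dilated tuples -/

/-- A union bound over the s coordinates, each handled by the Chernoff bound with N = pn after
dropping the divisibility condition. -/
lemma sum_multinomial_nsmul_tail_le {s p : ℕ} (hs : 1 ≤ s) (hp : 1 ≤ p) (n : ℕ) {η : ℝ}
    (hη : 0 < η) :
    ∑ a ∈ Finset.piAntidiag (Finset.univ : Finset (Fin s)) n with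
        ∃ i, (a i : ℝ) ≤ (1 - η) * (n / s), (Nat.multinomial Finset.univ (p • a) : ℝ)
      ≤ s * ((s : ℝ) ^ (p * n) * Real.exp (-(η ^ 2 / (2 * s) * n))) := by
  classical
  have hp' : (1 : ℝ) ≤ p := by exact_mod_cast hp
  have hs' : (0 : ℝ) < s := by exact_mod_cast hs
  have hone : ∀ i : Fin s, ∑ a ∈ Finset.piAntidiag (Finset.univ : Finset (Fin s)) n,
      (if (a i : ℝ) ≤ (1 - η) * (n / s) then (Nat.multinomial Finset.univ (p • a) : ℝ) else 0)
        ≤ (s : ℝ) ^ (p * n) * Real.exp (-(η ^ 2 / (2 * s) * n)) := by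
    intro i
    have h := sum_piAntidiag_nsmul (s := s) hp n (fun b =>
      if (b i : ℝ) ≤ (1 - η) * ((p * n : ℕ) / s) then (Nat.multinomial Finset.univ b : ℝ) else 0)
    have hiff : ∀ a : Fin s → ℕ, (((p • a) i : ℕ) : ℝ) ≤ (1 - η) * ((p * n : ℕ) / s) ↔
        (a i : ℝ) ≤ (1 - η) * (n / s) := by
      intro a
      simp only [Pi.smul_apply, smul_eq_mul, Nat.cast_mul]
      rw [show (1 - η) * ((p : ℝ) * n / s) = p * ((1 - η) * (n / s)) by ring]
      exact mul_le_mul_iff_right₀ (by linarith)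
    simp only [hiff] at h
    rw [h]
    refine (Finset.sum_le_sum_of_subset_of_nonneg (Finset.filter_subset _ _)
      fun b _ _ => by positivity).trans ?_
    rw [← Finset.sum_filter]
    refine (sum_multinomial_lower_tail_le hs (p * n) i hη).trans ?_
    gcongr
    -- The decay rate in pn is weakened to one in n, as p ≥ 1.
    nlinarith [Nat.cast_nonneg (α := ℝ) n]
  rw [Finset.sum_filter]
  calc _ ≤ ∑ a ∈ Finset.piAntidiag (Finset.univ : Finset (Fin s)) n, ∑ i,
      (if (a i : ℝ) ≤ (1 - η) * (n / s) then (Nat.multinomial Finset.univ (p • a) : ℝ) else 0) := by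
        refine Finset.sum_le_sum fun a _ => ?_
        split_ifs with h
        · obtain ⟨i, hi⟩ := h
          refine le_trans (by rw [if_pos hi]) (Finset.single_le_sum (f := fun i =>
            if (a i : ℝ) ≤ (1 - η) * (n / s) then (Nat.multinomial Finset.univ (p • a) : ℝ) else 0)
            (fun i _ => by positivity) (Finset.mem_univ i))
        · exact Finset.sum_nonneg fun i _ => by positivity
    _ ≤ ∑ _i : Fin s, (s : ℝ) ^ (p * n) * Real.exp (-(η ^ 2 / (2 * s) * n)) := by
        rw [Finset.sum_comm]
        exact Finset.sum_le_sum fun i _ => hone i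
    _ = _ := by simp

/-! ### The normalised product of ratios -/

/-- `∏ i, factorialRatio p (a i)`, normalised by its asymptotic value at `a i = n / s`. -/
noncomputable def normalizedRatio {s : ℕ} (p n : ℕ) (a : Fin s → ℕ) : ℝ :=
  ∏ i, (factorialRatio p (a i) * √(2 * Real.pi * (n / s)) ^ (p - 1) / √(p : ℝ))

lemma normalizedRatio_nonneg {s p : ℕ} (hp : 1 ≤ p) (n : ℕ) (a : Fin s → ℕ) :
    0 ≤ normalizedRatio p n a :=
  Finset.prod_nonneg fun i _ => by
    have := factorialRatio_pos hp (a i)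
    positivity

/-- A crude bound uniform in a, from `factorialRatio_le_one`; polynomial growth is enough against
the exponential tail. -/
lemma normalizedRatio_le {s p n : ℕ} (hs : 1 ≤ s) (hp : 1 ≤ p) (hn : 1 ≤ n) (a : Fin s → ℕ) :
    normalizedRatio p n a ≤ (2 * Real.pi * n) ^ ((p - 1) * s) := by
  have hp' : (1 : ℝ) ≤ p := by exact_mod_cast hp
  have hs' : (1 : ℝ) ≤ s := by exact_mod_cast hs
  have hn' : (1 : ℝ) ≤ n := by exact_mod_cast hn
  have hpi := Real.pi_gt_three
  have hbig : 1 ≤ 2 * Real.pi * n := by nlinarith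
  have hsqrt : √(2 * Real.pi * (n / s)) ≤ 2 * Real.pi * n := by
    rw [Real.sqrt_le_left (by linarith)]
    have : (n : ℝ) / s ≤ n := div_le_self (by linarith) hs'
    nlinarith
  have hsp : 1 ≤ √(p : ℝ) := Real.one_le_sqrt.2 hp'
  calc normalizedRatio p n a ≤ ∏ _i : Fin s, (2 * Real.pi * n) ^ (p - 1) := by
        refine Finset.prod_le_prod (fun i _ => ?_) fun i _ => ?_
        · have := factorialRatio_pos hp (a i)
          positivity
        · have := factorialRatio_pos hp (a i)
          refine (div_le_self (by positivity) hsp).trans ?_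
          refine (mul_le_of_le_one_left (by positivity) (factorialRatio_le_one hp _)).trans ?_
          gcongr
    _ = _ := by simp [pow_mul]

/-- If every entry of `a` is at least `(1 - η) n / s`, every entry is close to `n / s`. -/
lemma abs_mul_div_sub_one_lt {s n : ℕ} (hs : 1 ≤ s) (hn : 1 ≤ n) {η : ℝ} (hη : 0 < η)
    {a : Fin s → ℕ} (ha : a ∈ Finset.piAntidiag (Finset.univ : Finset (Fin s)) n)
    (h : ∀ i, (1 - η) * (n / s) < a i) (i : Fin s) : |(s : ℝ) * a i / n - 1| < s * η := by
  have hs' : (1 : ℝ) ≤ s := by exact_mod_cast hs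
  have hn' : (1 : ℝ) ≤ n := by exact_mod_cast hn
  have hs0 : (0 : ℝ) < s := by linarith
  have hn0 : (0 : ℝ) < n := by linarith
  have hlow : ∀ j, (1 - η) * n < s * a j := fun j => by
    have := h j
    rw [← mul_div_assoc, div_lt_iff₀ hs0] at this
    linarith
  have hsum : ∑ j, (a j : ℝ) = n := by exact_mod_cast (Finset.mem_piAntidiag.1 ha).1
  -- The entries sum to n, so lower bounds on the other s - 1 entries force s·a_i ≤ n + (s - 1)ηn.
  have hup : s * (a i : ℝ) ≤ s * n - (s - 1) * ((1 - η) * n) := by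
    rw [← Finset.add_sum_erase _ _ (Finset.mem_univ i)] at hsum
    have : (s - 1 : ℝ) * ((1 - η) * n) ≤ ∑ j ∈ Finset.univ.erase i, s * (a j : ℝ) := by
      refine le_trans (le_of_eq ?_) (Finset.sum_le_sum fun j _ => (hlow j).le)
      rw [Finset.sum_const, nsmul_eq_mul]
      simp [Finset.card_erase_of_mem, Nat.cast_sub hs]
    rw [← Finset.mul_sum] at this
    rw [← hsum] at this ⊢
    nlinarith
  have hηn : 0 < η * n := mul_pos hη hn0
  rw [abs_lt, sub_lt_iff_lt_add, lt_sub_iff_add_lt, div_lt_iff₀ hn0, lt_div_iff₀ hn0]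
  constructor
  · nlinarith [hlow i]
  · nlinarith

/-- Continuity at the all-ones point. In use, u_i is the Stirling quotient at a_i and v_i = s·a_i/n
corrects for normalising at n/s instead of a_i. -/
lemma exists_forall_abs_prod_sub_one_lt (s q : ℕ) {ε : ℝ} (hε : 0 < ε) :
    ∃ δ > 0, ∀ u v : Fin s → ℝ, (∀ i, |u i - 1| < δ) → (∀ i, |v i - 1| < δ) →
      |∏ i, (u i * √((v i)⁻¹) ^ q) - 1| < ε := by
  have hcont : ContinuousAt
      (fun x : (Fin s → ℝ) × (Fin s → ℝ) => ∏ i, (x.1 i * √((x.2 i)⁻¹) ^ q))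
      (fun _ => 1, fun _ => 1) := by
    refine tendsto_finsetProd _ fun i _ => ?_
    have h1 : ContinuousAt (fun x : (Fin s → ℝ) × (Fin s → ℝ) => x.1 i)
      (fun _ => 1, fun _ => 1) := by fun_prop
    have h2 : ContinuousAt (fun x : (Fin s → ℝ) × (Fin s → ℝ) => x.2 i)
      (fun _ => 1, fun _ => 1) := by fun_prop
    exact h1.mul ((h2.inv₀ one_ne_zero).sqrt.pow q)
  obtain ⟨δ, hδ, h⟩ := Metric.continuousAt_iff.1 hcont ε hε
  refine ⟨δ, hδ, fun u v hu hv => ?_⟩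
  have := @h (u, v) (by
    rw [Prod.dist_eq, max_lt_iff, dist_pi_lt_iff hδ, dist_pi_lt_iff hδ]
    exact ⟨hu, hv⟩)
  simpa [Real.dist_eq] using this

/-- The normalised ratio is close to `1` at all tuples all of whose entries are nearly at
least `n / s`. -/
lemma exists_eventually_abs_normalizedRatio_sub_one_lt {s p : ℕ} (hs : 1 ≤ s) (hp : 1 ≤ p) {ε : ℝ}
    (hε : 0 < ε) :
    ∃ η > 0, ∀ᶠ n : ℕ in Filter.atTop,
      ∀ a ∈ Finset.piAntidiag (Finset.univ : Finset (Fin s)) n,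
        (∀ i, (1 - η) * ((n : ℝ) / s) < a i) → |normalizedRatio p n a - 1| < ε := by
  have hs0 : (0 : ℝ) < s := by exact_mod_cast hs
  obtain ⟨δ, hδ, h⟩ := exists_forall_abs_prod_sub_one_lt s (p - 1) hε
  obtain ⟨A, hA⟩ := Filter.eventually_atTop.1
    ((tendsto_factorialRatio hp).eventually (Metric.ball_mem_nhds 1 hδ))
  -- The bound δ/s puts s·a_i/n within δ of 1; the bound 1/2 gives a_i > n/(2s), which passes the
  -- Stirling threshold A once n ≥ 2sA.
  refine ⟨min (δ / s) (1 / 2), by positivity, ?_⟩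
  set η := min (δ / s) (1 / 2) with hηdef
  have hη : 0 < η := by positivity
  have hη1 : η ≤ 1 / 2 := min_le_right _ _
  have hη2 : s * η ≤ δ := by
    have : η ≤ δ / s := min_le_left _ _
    rwa [le_div_iff₀ hs0, mul_comm] at this
  filter_upwards [Filter.eventually_ge_atTop 1, Filter.eventually_ge_atTop (2 * s * A)]
    with n hn hnA a ha hgood
  have hn0 : (0 : ℝ) < n := by exact_mod_cast hn
  have hpos : ∀ i, 0 < (a i : ℝ) := fun i =>
    lt_of_le_of_lt (by have : 0 ≤ 1 - η := by linarith
                       positivity) (hgood i)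
  have hbig : ∀ i, A ≤ a i := fun i => by
    have h1 : (2 * s * A : ℝ) ≤ n := by exact_mod_cast hnA
    have h2 := hgood i
    rw [← mul_div_assoc, div_lt_iff₀ hs0] at h2
    have h3 : (s : ℝ) * A < s * a i := by nlinarith
    exact_mod_cast (lt_of_mul_lt_mul_left h3 hs0.le).le
  have key := h (fun i => factorialRatio p (a i) * √(2 * Real.pi * (a i : ℕ)) ^ (p - 1) / √(p : ℝ))
    (fun i => s * a i / n)
    (fun i => by have := hA (a i) (hbig i); rwa [Real.dist_eq] at this)
    (fun i => (abs_mul_div_sub_one_lt hs hn hη ha hgood i).trans_le hη2)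
  convert key using 3
  refine Finset.prod_congr rfl fun i _ => ?_
  have hi := hpos i
  have : √(2 * Real.pi * (n / s)) = √(2 * Real.pi * a i) * √((s * a i / n : ℝ)⁻¹) := by
    rw [← Real.sqrt_mul (by positivity)]
    congr 1
    field_simp
  rw [this, mul_pow]
  ring

/-! ### Concentration and the final asymptotics -/

lemma tendsto_const_mul_pow_mul_exp_neg (C : ℝ) (K : ℕ) {c : ℝ} (hc : 0 < c) :
    Filter.Tendsto (fun n : ℕ => C * ((2 * Real.pi * n) ^ K * Real.exp (-(c * n))))
      Filter.atTop (nhds 0) := by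
  have h := ((Real.tendsto_pow_mul_exp_neg_atTop_nhds_zero K).comp
    (tendsto_natCast_atTop_atTop.const_mul_atTop hc)).const_mul (C * (2 * Real.pi / c) ^ K)
  rw [mul_zero] at h
  refine h.congr fun n => ?_
  simp only [Function.comp_apply]
  have hbase : 2 * Real.pi / c * (c * n) = 2 * Real.pi * n := by field_simp
  rw [mul_assoc, ← mul_assoc (_ ^ K) (_ ^ K), ← mul_pow, hbase]

/-- The weights have total mass tending to 1. The normalised ratio is near 1 on the good tuples, and
on the others its polynomial bound is beaten by the exponentially small mass. -/
lemma tendsto_sum_multinomial_nsmul_mul_normalizedRatio {s p : ℕ} (hs : 1 ≤ s) (hp : 1 ≤ p) :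
    Filter.Tendsto (fun n : ℕ => ∑ a ∈ Finset.piAntidiag (Finset.univ : Finset (Fin s)) n,
        (Nat.multinomial Finset.univ (p • a) : ℝ) * ((p : ℝ) ^ (s - 1) / (s : ℝ) ^ (p * n)) *
          normalizedRatio p n a)
      Filter.atTop (nhds 1) := by
  classical
  have hs0 : (0 : ℝ) < s := by exact_mod_cast hs
  have hW := tendsto_sum_multinomial_nsmul hs hp
  refine hW.congr_dist (Metric.tendsto_atTop'.2 ?_)
  intro ε hε
  obtain ⟨η, hη, hgood⟩ :=
    exists_eventually_abs_normalizedRatio_sub_one_lt hs hp (by positivity : 0 < ε / 4)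
  -- The constant collects the 2 of the bound 2B below, the s of the union bound and the p^(s-1) of
  -- the weights.
  have htail := tendsto_const_mul_pow_mul_exp_neg (2 * (s * (p : ℝ) ^ (s - 1))) ((p - 1) * s)
    (c := η ^ 2 / (2 * s)) (by positivity)
  refine Filter.eventually_atTop.1 ?_ |>.imp fun N hN n hn => hN n hn.le
  filter_upwards [hgood, hW.eventually_lt_const one_lt_two,
    htail.eventually_lt_const (by positivity : 0 < ε / 2), Filter.eventually_ge_atTop 1]
    with n hn hW2 htl hn1
  have hn' : (1 : ℝ) ≤ n := by exact_mod_cast hn1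
  have hbig : 1 ≤ 2 * Real.pi * n := by nlinarith [Real.pi_gt_three]
  set W : (Fin s → ℕ) → ℝ := fun a =>
    (Nat.multinomial Finset.univ (p • a) : ℝ) * ((p : ℝ) ^ (s - 1) / (s : ℝ) ^ (p * n)) with hWdef
  have hW0 : ∀ a, 0 ≤ W a := fun a => by positivity
  set B := (2 * Real.pi * (n : ℝ)) ^ ((p - 1) * s) with hB
  have hB1 : 1 ≤ B := one_le_pow₀ hbig
  rw [Real.dist_0_eq_abs, abs_of_nonneg dist_nonneg, Real.dist_eq, abs_sub_comm,
    ← Finset.sum_sub_distrib]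
  calc |∑ a ∈ Finset.piAntidiag Finset.univ n, (W a * normalizedRatio p n a - W a)|
      ≤ ∑ a ∈ Finset.piAntidiag Finset.univ n, |W a * normalizedRatio p n a - W a| :=
        Finset.abs_sum_le_sum_abs _ _
    -- Good tuples cost ε/4 each per unit of weight, and the total weight is below 2; bad ones cost
    -- at most 2B, since the ratio lies in [0, B] and B ≥ 1.
    _ ≤ ∑ a ∈ Finset.piAntidiag Finset.univ n, (W a * (ε / 4) +
          if ∃ i, (a i : ℝ) ≤ (1 - η) * (n / s) then W a * (2 * B) else 0) := by
        refine Finset.sum_le_sum fun a ha => ?_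
        rw [← mul_sub_one, abs_mul, abs_of_nonneg (hW0 a)]
        split_ifs with hbad
        · have h0 := normalizedRatio_nonneg hp n a
          have h1 := normalizedRatio_le hs hp hn1 a
          have : |normalizedRatio p n a - 1| ≤ 2 * B := by
            rw [abs_le]; constructor <;> linarith
          have h2 := mul_le_mul_of_nonneg_left this (hW0 a)
          have h3 : 0 ≤ W a * (ε / 4) := mul_nonneg (hW0 a) (by positivity)
          linarith
        · push Not at hbad
          rw [add_zero]
          exact mul_le_mul_of_nonneg_left (hn a ha hbad).le (hW0 a)
    _ = (∑ a ∈ Finset.piAntidiag Finset.univ n, W a) * (ε / 4) +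
          (∑ a ∈ Finset.piAntidiag (Finset.univ : Finset (Fin s)) n with
            ∃ i, (a i : ℝ) ≤ (1 - η) * (n / s), (Nat.multinomial Finset.univ (p • a) : ℝ)) *
            ((p : ℝ) ^ (s - 1) / (s : ℝ) ^ (p * n) * (2 * B)) := by
        rw [Finset.sum_add_distrib, ← Finset.sum_mul, ← Finset.sum_filter,
          Finset.sum_mul _ _ (_ * (2 * B))]
        simp only [hWdef, mul_assoc]
    _ ≤ 2 * (ε / 4) + (s * ((s : ℝ) ^ (p * n) * Real.exp (-(η ^ 2 / (2 * s) * n)))) *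
            ((p : ℝ) ^ (s - 1) / (s : ℝ) ^ (p * n) * (2 * B)) := by
        gcongr
        exact sum_multinomial_nsmul_tail_le hs hp n hη
    _ = ε / 2 + 2 * (s * (p : ℝ) ^ (s - 1)) * (B * Real.exp (-(η ^ 2 / (2 * s) * n))) := by
        field_simp
        ring
    _ < ε := by linarith

theorem lemma2p4 (s p : ℕ) (hs : 1 ≤ s) (hp : 1 ≤ p) :
    Asymptotics.IsEquivalent Filter.atTop
      (fun n : ℕ => ∑ a ∈ Finset.piAntidiag (Finset.univ : Finset (Fin s)) n,
        ((Nat.multinomial Finset.univ a : ℕ) : ℝ) ^ p)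
      (fun n : ℕ => (s : ℝ) ^ (p * n) *
        Real.sqrt ((s : ℝ) ^ (s * (p - 1)) /
          ((p : ℝ) ^ (s - 1) * (2 * Real.pi * (n : ℝ)) ^ ((s - 1) * (p - 1))))) := by
  have hs0 : (0 : ℝ) < s := by exact_mod_cast hs
  have hp0 : (0 : ℝ) < p := by exact_mod_cast hp
  -- The denominator supplies the asymptotics of the outer factor R(n)⁻¹.
  have hlim := (tendsto_sum_multinomial_nsmul_mul_normalizedRatio hs hp).div
    (tendsto_factorialRatio hp) one_ne_zero
  rw [div_one] at hlim
  refine Asymptotics.isEquivalent_of_tendsto_one (hlim.congr' ?_)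
  filter_upwards [Filter.eventually_ge_atTop 1] with n hn
  have hn0 : (0 : ℝ) < n := by exact_mod_cast hn
  have hh := factorialRatio_pos hp n
  simp only [Pi.div_apply]
  rw [Finset.sum_congr rfl fun a ha => multinomial_pow_eq hp a ha, ← Finset.mul_sum]
  have hG : ∀ a : Fin s → ℕ, normalizedRatio p n a = (∏ i, factorialRatio p (a i)) *
      (√(2 * Real.pi * n) ^ (p - 1) / √(s : ℝ) ^ (p - 1) / √(p : ℝ)) ^ s := by
    intro a
    rw [normalizedRatio, ← mul_div_assoc, Real.sqrt_div (by positivity), div_pow]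
    simp only [mul_div_assoc, Finset.prod_mul_distrib, Finset.prod_const, Finset.card_univ,
      Fintype.card_fin]
  have hsum : ∑ a ∈ Finset.piAntidiag (Finset.univ : Finset (Fin s)) n,
        (Nat.multinomial Finset.univ (p • a) : ℝ) * ((p : ℝ) ^ (s - 1) / (s : ℝ) ^ (p * n)) *
          normalizedRatio p n a
      = (∑ a ∈ Finset.piAntidiag (Finset.univ : Finset (Fin s)) n,
          (Nat.multinomial Finset.univ (p • a) : ℝ) * ∏ i, factorialRatio p (a i)) *
        (((p : ℝ) ^ (s - 1) / (s : ℝ) ^ (p * n)) *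
          (√(2 * Real.pi * n) ^ (p - 1) / √(s : ℝ) ^ (p - 1) / √(p : ℝ)) ^ s) := by
    rw [Finset.sum_mul]
    refine Finset.sum_congr rfl fun a _ => ?_
    rw [hG]
    ring
  have hsqrt : ∀ (x : ℝ) (k : ℕ), 0 ≤ x → √(x ^ k) = √x ^ k := fun x k hx => by
    rw [Real.sqrt_eq_iff_eq_sq (by positivity) (by positivity), ← pow_mul, mul_comm, pow_mul,
      Real.sq_sqrt hx]
  rw [hsum, Real.sqrt_div (by positivity), Real.sqrt_mul (x := (p : ℝ) ^ (s - 1)) (by positivity), hsqrt _ _ hs0.le,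
    hsqrt _ _ hp0.le, hsqrt _ _ (by positivity)]
  -- With p^(s-1) written through √p, what remains is an identity of monomials in √(2πn), √s and √p.
  have hpp : (p : ℝ) ^ (s - 1) = √(p : ℝ) ^ (s - 1) * √(p : ℝ) ^ (s - 1) := by
    rw [← mul_pow, Real.mul_self_sqrt hp0.le]
  rw [hpp]
  have hX : 0 < √(2 * Real.pi * n) := Real.sqrt_pos.2 (by positivity)
  have hS : 0 < √(s : ℝ) := Real.sqrt_pos.2 hs0
  have hP : 0 < √(p : ℝ) := Real.sqrt_pos.2 hp0
  generalize √(2 * Real.pi * n) = X at *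
  generalize √(s : ℝ) = S at *
  generalize √(p : ℝ) = P at *
  obtain ⟨t, rfl⟩ : ∃ t, s = t + 1 := ⟨s - 1, by omega⟩
  simp only [Nat.add_sub_cancel, div_pow, ← pow_mul]
  rw [mul_comm t (p - 1), mul_comm (t + 1) (p - 1), mul_add_one (p - 1) t, pow_add X, pow_succ P t]
  field_simp
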